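/- A stationary dimension group $\mathcal E_A$ is given by an automorphism $A\in GL_n(\mathbb Z)$, $n\ge 1$, with strictly positive entries: it is the ordered abelian group $\varinjlim(\mathbb Z^n\xrightarrow{A}\mathbb Z^n\xrightarrow{A}\cdots)$, whose positive cone is the union of the images of the cones $\mathbb Z^n_{+}$ of all stages. Two such groups are Morita equivalent if they are isomorphic as ordered abelian groups (the order units are disregarded). The field associated to $\mathcal E_A$ is the subfield of $\mathbb R$ generated over $\mathbb Q$ by the slopes $\tau(x)/\tau(y)$, where $\tau:\mathcal E_A\to\mathbb R$ is a nonzero positive homomorphism and $\tau(y)\ne 0$ (for $n=2$ it is $\mathbb Q(\theta)$, with $\theta$ the rotation number). Let $\mathrm{End}\,\mathcal E_A$ be the subring of the endomorphism ring of the abelian group $\mathcal E_A$ generated by the endomorphisms that preserve the positive cone. Let $\mathcal E_A$ be a stationary dimension group whose associated field is the real quadratic field $K=\mathbb Q(\sqrt d)$, with $d>1$ a squarefree integer, let $O_K$ be the ring of integers of $K$, and suppose that the class number $h_K$ of $K$ is bigger than $1$. Then there exist stationary dimension groups $\mathcal E^{(1)},\dots,\mathcal E^{(h_K)}$, all with associated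 field $K$ and with $\mathrm{End}\,\mathcal E^{(i)}\cong O_K$, which are pairwise not Morita equivalent, and every stationary dimension group with associated field $K$ and with order-endomorphism ring isomorphic to $O_K$ is Morita equivalent to one of them. In particular there are at least $h_K$ distinct Morita equivalence classes of stationary dimension groups with associated field $K$, and exactly $h_K$ of them have order-endomorphism ring $O_K$. -/

import Mathlib

open scoped NumberField

noncomputable section

/-- The data of a stationary dimension group: an automorphism `A` of the lattice `ℤⁿ` (an integer
matrix invertible over `ℤ`), all of whose entries are strictly positive. -/
structure StationaryDimensionGroup where
  /-- the rank of the lattice -/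
  n : ℕ
  n_pos : 0 < n
  /-- the constant incidence matrix -/
  A : Matrix (Fin n) (Fin n) ℤ
  isUnit_det : IsUnit A.det
  pos : ∀ i j, 0 < A i j

namespace StationaryDimensionGroup

variable (E : StationaryDimensionGroup)

/-- The bonding map `ℤⁿ → ℤⁿ` from stage `i` to stage `j` of the stationary system
`ℤⁿ --A--> ℤⁿ --A--> ℤⁿ --A--> ⋯`. -/
def bonding (i j : ℕ) (_ : i ≤ j) : (Fin E.n → ℤ) →+ (Fin E.n → ℤ) :=
  (Matrix.mulVecLin (E.A ^ (j - i))).toAddMonoidHom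

/-- The underlying abelian group of the dimension group: the inductive limit of the system. -/
abbrev Carrier : Type :=
  AddCommGroup.DirectLimit (fun _ : ℕ => Fin E.n → ℤ) E.bonding

/-- The canonical map from the `i`-th stage to the limit. -/
def ofStage (i : ℕ) : (Fin E.n → ℤ) →+ E.Carrier :=
  AddCommGroup.DirectLimit.of (fun _ : ℕ => Fin E.n → ℤ) E.bonding i

/-- The positive cone of the limit of the simplicial groups `(ℤⁿ, ℤⁿ₊)`: the union of the images of
the cones `ℤⁿ₊` of all stages. -/
def posCone : Set E.Carrier :=
  {x | ∃ (i : ℕ) (v : Fin E.n → ℤ), 0 ≤ v ∧ E.ofStage i v = x}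

/-- Two dimension groups are Morita equivalent if they are isomorphic as ordered abelian groups
(the order units need not correspond). -/
def MoritaEquiv (E F : StationaryDimensionGroup) : Prop :=
  ∃ e : E.Carrier ≃+ F.Carrier, e '' E.posCone = F.posCone

theorem MoritaEquiv.refl (E : StationaryDimensionGroup) : MoritaEquiv E E :=
  ⟨AddEquiv.refl _, by simp⟩

theorem MoritaEquiv.symm {E F : StationaryDimensionGroup} :
    MoritaEquiv E F → MoritaEquiv F E := by
  rintro ⟨e, he⟩
  refine ⟨e.symm, ?_⟩
  rw [← he, Set.image_image]
  simp

theorem MoritaEquiv.trans {E F G : StationaryDimensionGroup} :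
    MoritaEquiv E F → MoritaEquiv F G → MoritaEquiv E G := by
  rintro ⟨e, he⟩ ⟨f, hf⟩
  refine ⟨e.trans f, ?_⟩
  rw [← hf, ← he, Set.image_image]
  simp

/-- Morita equivalence as an equivalence relation. -/
def moritaSetoid : Setoid StationaryDimensionGroup where
  r := MoritaEquiv
  iseqv := ⟨MoritaEquiv.refl, MoritaEquiv.symm, MoritaEquiv.trans⟩

/-- The Morita equivalence class of a stationary dimension group. -/
def moritaClass : Quotient moritaSetoid :=
  Quotient.mk moritaSetoid E

/-- The ring of order-endomorphisms: the subring of the endomorphism ring of the abelian group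
generated by the endomorphisms that preserve the positive cone. -/
def orderEnd : Subring (AddMonoid.End E.Carrier) :=
  Subring.closure {f | ∀ x ∈ E.posCone, f x ∈ E.posCone}

/-- A (not normalized) state: a nonzero additive map to `ℝ` that is nonnegative on the positive
cone. -/
def IsState (τ : E.Carrier →+ ℝ) : Prop :=
  τ ≠ 0 ∧ ∀ x ∈ E.posCone, 0 ≤ τ x

/-- The set of slopes `τ x / τ y` of the dimension group. In rank two, identify the limit with stage
`0` and let `e₁, e₂` be the standard basis: then the positive cone is the union of `{0}` and the open
half-plane `{x₁ + θ x₂ > 0}`, where `θ = τ e₂ / τ e₁` is the rotation number. -/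
def slopes : Set ℝ :=
  {θ | ∃ τ : E.Carrier →+ ℝ, E.IsState τ ∧ ∃ x y, τ y ≠ 0 ∧ θ = τ x / τ y}

/-- The number field associated to the dimension group, as a subfield of `ℝ`: it is generated by the
slopes. In rank two it is `ℚ(θ)`, where `θ` is the rotation number. -/
def associatedField : IntermediateField ℚ ℝ :=
  IntermediateField.adjoin ℚ E.slopes

end StationaryDimensionGroup

/-- The real quadratic field `ℚ(√d)` (for `d > 1` squarefree). -/
def realQuadraticField (d : ℕ) : IntermediateField ℚ ℝ :=
  IntermediateField.adjoin ℚ {Real.sqrt d}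

instance (d : ℕ) : NumberField (realQuadraticField d) where
  to_charZero := inferInstance
  to_finiteDimensional := by
    unfold realQuadraticField
    apply IntermediateField.adjoin.finiteDimensional
    refine ⟨Polynomial.X ^ 2 - Polynomial.C (d : ℚ), ?_, ?_⟩
    · exact Polynomial.monic_X_pow_sub_C _ two_ne_zero
    · simp

end

/-! Since `A` is invertible, the limit is the lattice `ℤⁿ`; only its order is at stake. A positive
matrix contracts the directions of vectors (Perron–Frobenius), so once a state `τ` exists, the
positive cone is exactly `{0} ∪ {τ > 0}` and all states are proportional (`mem_posCone_iff`,
`exists_pos_eq_mul`). If moreover `τ` is injective, the ordered group is the lattice `τ(E) ⊂ ℝ`: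
slopes are ratios of its elements, order-endomorphisms are its multipliers (`mem_range_scalar_iff`),
and Morita equivalence is positive homothety (`moritaEquiv_iff`).

The classification thus becomes that of lattices in `K` with multiplier ring `O_K`. If the
order-endomorphism ring is `O_K`, it is reduced, which forces `τ` to be injective, and a positive
multiple of `τ(E)` is a nonzero ideal (`exists_ideal_of_orderEnd_equiv`). As `-I = I`, positive
homothety of ideals is equality in the ordinary class group (`exists_image_eq_iff`).

Conversely, each nonzero ideal `I` occurs (`exists_stationaryDimensionGroup`): in a basis of
positive numbers whose conjugates have opposite signs, multiplication by a high power of a unit `ε >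
1` of norm `1` has a strictly positive matrix, for which the basis is a left eigenvector. -/

noncomputable section

/-! ### Contraction by positive matrices -/

namespace Matrix

variable {ι : Type*} [Fintype ι]

theorem mulVec_le_mulVec_of_nonneg {B : Matrix ι ι ℝ} (hB : ∀ i j, 0 < B i j) {u v : ι → ℝ}
    (h : ∀ i, u i ≤ v i) (i : ι) : (B *ᵥ u) i ≤ (B *ᵥ v) i :=
  Finset.sum_le_sum fun j _ => mul_le_mul_of_nonneg_left (h j) (hB i j).le

theorem mulVec_pos_of_pos [Nonempty ι] {B : Matrix ι ι ℝ} (hB : ∀ i j, 0 < B i j) {v : ι → ℝ}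
    (h : ∀ i, 0 < v i) (i : ι) : 0 < (B *ᵥ v) i :=
  Finset.sum_pos (fun j _ => mul_pos (hB i j) (h j)) Finset.univ_nonempty

theorem pow_mulVec_one_pos [DecidableEq ι] [Nonempty ι] {B : Matrix ι ι ℝ}
    (hB : ∀ i j, 0 < B i j) (k : ℕ) (i : ι) : 0 < ((B ^ k) *ᵥ 1) i := by
  induction k generalizing i with
  | zero => simp
  | succ k ih =>
    rw [pow_succ', ← Matrix.mulVec_mulVec]
    exact mulVec_pos_of_pos hB ih i

/-- The coordinates of the iterates of the all-ones vector under a positive matrix stay uniformly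
comparable. -/
theorem exists_pow_mulVec_one_le [DecidableEq ι] [Nonempty ι] {B : Matrix ι ι ℝ}
    (hB : ∀ i j, 0 < B i j) :
    ∃ C : ℝ, 0 < C ∧ ∀ k i j, ((B ^ k) *ᵥ 1) i ≤ C * ((B ^ k) *ᵥ 1) j := by
  obtain ⟨C, hC⟩ : ∃ C : ℝ, ∀ p : ι × ι × ι, B p.1 p.2.2 / B p.2.1 p.2.2 ≤ C := by
    obtain ⟨C, hC⟩ := (Set.finite_range
      fun p : ι × ι × ι => B p.1 p.2.2 / B p.2.1 p.2.2).bddAbove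
    exact ⟨C, fun p => hC ⟨p, rfl⟩⟩
  -- The `1` covers `k = 0`, where all coordinates are equal, and makes the constant positive.
  refine ⟨max C 1, by positivity, fun k => ?_⟩
  cases k with
  | zero => intro i j; simp
  | succ k =>
    have hpos := pow_mulVec_one_pos hB k
    intro i j
    rw [pow_succ', ← Matrix.mulVec_mulVec]
    simp only [Matrix.mulVec, dotProduct] at hpos ⊢
    rw [Finset.mul_sum]
    refine Finset.sum_le_sum fun l _ => ?_
    rw [← mul_assoc]
    refine mul_le_mul_of_nonneg_right ?_ (hpos l).le
    have := hC (i, j, l)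
    rw [div_le_iff₀ (hB j l)] at this
    exact this.trans (mul_le_mul_of_nonneg_right (le_max_left _ _) (hB j l).le)

/-- A positive matrix contracts the oscillation of the ratios of the coordinates of the iterates of
a vector to the iterates of the all-ones vector. -/
theorem exists_pow_mulVec_ratio_bounds [DecidableEq ι] [Nonempty ι] {B : Matrix ι ι ℝ}
    (hB : ∀ i j, 0 < B i j) (v : ι → ℝ) :
    ∃ q D : ℝ, 0 ≤ q ∧ q < 1 ∧ ∀ k : ℕ, ∃ m M : ℝ, m ≤ M ∧ M - m ≤ q ^ k * D ∧
      ∀ i, m * ((B ^ k) *ᵥ 1) i ≤ ((B ^ k) *ᵥ v) i ∧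
        ((B ^ k) *ᵥ v) i ≤ M * ((B ^ k) *ᵥ 1) i := by
  obtain ⟨C, hC0, hC⟩ := exists_pow_mulVec_one_le hB
  have hy := pow_mulVec_one_pos hB
  -- By comparability of coordinates, each single term of the sum defining the next iterate is at
  -- least a fixed fraction of it, uniformly in `k`. The half anticipates a gain of half the width
  -- `M - m` at one coordinate.
  obtain ⟨δ, hδ0, hδ1, hδ⟩ : ∃ δ : ℝ, 0 < δ ∧ δ ≤ 1 ∧ ∀ k i j,
      δ * ((B ^ (k + 1)) *ᵥ 1) i ≤ B i j * (((B ^ k) *ᵥ 1) j / 2) := by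
    obtain ⟨c, hc0, hc⟩ : ∃ c : ℝ, 0 < c ∧ ∀ i j, c * ∑ l, B i l ≤ B i j := by
      obtain ⟨p, hp⟩ := Finite.exists_min fun p : ι × ι => B p.1 p.2 / ∑ l, B p.1 l
      have hs : ∀ i, 0 < ∑ l, B i l := fun i =>
        Finset.sum_pos (fun j _ => hB i j) Finset.univ_nonempty
      refine ⟨_, div_pos (hB p.1 p.2) (hs p.1), fun i j => ?_⟩
      rw [← le_div_iff₀ (hs i)]
      exact hp (i, j)
    refine ⟨min 1 (c / (2 * C)), by positivity, min_le_left _ _, fun k i j => ?_⟩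
    have h1 : ((B ^ (k + 1)) *ᵥ 1) i ≤ (∑ l, B i l) * (C * ((B ^ k) *ᵥ 1) j) := by
      rw [pow_succ', ← Matrix.mulVec_mulVec, Finset.sum_mul]
      exact Finset.sum_le_sum fun l _ => mul_le_mul_of_nonneg_left (hC k l j) (hB i l).le
    calc min 1 (c / (2 * C)) * ((B ^ (k + 1)) *ᵥ 1) i
        ≤ c / (2 * C) * ((∑ l, B i l) * (C * ((B ^ k) *ᵥ 1) j)) :=
          mul_le_mul (min_le_right _ _) h1 (hy _ _).le (by positivity)
      _ = c * (∑ l, B i l) * (((B ^ k) *ᵥ 1) j / 2) := by field_simp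
      _ ≤ _ := mul_le_mul_of_nonneg_right (hc i j) (by linarith [hy k j])
  obtain ⟨D, hD⟩ : ∃ D : ℝ, ∀ i, |v i| ≤ D := by
    obtain ⟨C, hC⟩ := (Set.finite_range fun i => |v i|).bddAbove
    exact ⟨C, fun p => hC ⟨p, rfl⟩⟩
  refine ⟨1 - δ, 2 * D, by linarith, by linarith, fun k => ?_⟩
  induction k with
  | zero =>
    have : 0 ≤ D := (abs_nonneg _).trans (hD (Classical.arbitrary ι))
    refine ⟨-D, D, by linarith, by linarith, fun i => ?_⟩
    simpa using abs_le.mp (hD i)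
  | succ k ih =>
    obtain ⟨m, M, hmM, hD, hb⟩ := ih
    obtain ⟨j⟩ := ‹Nonempty ι›
    have key : ∀ u : ι → ℝ, (∀ i, 0 ≤ u i) → (M - m) * (((B ^ k) *ᵥ 1) j / 2) ≤ u j →
        ∀ i, δ * (M - m) * ((B ^ (k + 1)) *ᵥ 1) i ≤ (B *ᵥ u) i := by
      intro u hu huj i
      calc δ * (M - m) * ((B ^ (k + 1)) *ᵥ 1) i
          = (M - m) * (δ * ((B ^ (k + 1)) *ᵥ 1) i) := by ring
        _ ≤ (M - m) * (B i j * (((B ^ k) *ᵥ 1) j / 2)) :=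
            mul_le_mul_of_nonneg_left (hδ k i j) (by linarith)
        _ = B i j * ((M - m) * (((B ^ k) *ᵥ 1) j / 2)) := by ring
        _ ≤ B i j * u j := mul_le_mul_of_nonneg_left huj (hB i j).le
        _ ≤ _ := Finset.single_le_sum (f := fun l => B i l * u l)
            (fun l _ => mul_nonneg (hB i l).le (hu l)) (Finset.mem_univ j)
    have hstep : ∀ x : ι → ℝ, (B ^ (k + 1)) *ᵥ x = B *ᵥ ((B ^ k) *ᵥ x) := fun x => by
      rw [pow_succ', ← Matrix.mulVec_mulVec]
    have hwidth : (1 - δ) * (M - m) ≤ (1 - δ) ^ (k + 1) * (2 * D) := by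
      rw [pow_succ', mul_assoc]
      exact mul_le_mul_of_nonneg_left hD (by linarith)
    have hw0 : 0 ≤ (1 - δ) * (M - m) := mul_nonneg (by linarith) (by linarith)
    have lower : ∀ i, m * ((B ^ (k + 1)) *ᵥ 1) i ≤ ((B ^ (k + 1)) *ᵥ v) i := fun i => by
      have := mulVec_le_mulVec_of_nonneg hB (u := m • ((B ^ k) *ᵥ 1)) (v := (B ^ k) *ᵥ v)
        (fun i => (hb i).1) i
      rwa [Matrix.mulVec_smul, ← hstep, ← hstep] at this
    have upper : ∀ i, ((B ^ (k + 1)) *ᵥ v) i ≤ M * ((B ^ (k + 1)) *ᵥ 1) i := fun i => by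
      have := mulVec_le_mulVec_of_nonneg hB (v := M • ((B ^ k) *ᵥ 1)) (u := (B ^ k) *ᵥ v)
        (fun i => (hb i).2) i
      rwa [Matrix.mulVec_smul, ← hstep, ← hstep] at this
    -- The ratio at `j` lies on one side of the midpoint; above it the lower bound can be raised by
    -- `δ (M - m)`, below it the upper bound can be lowered by as much.
    rcases le_total ((M + m) / 2 * ((B ^ k) *ᵥ 1) j) (((B ^ k) *ᵥ v) j) with h | h
    · refine ⟨m + δ * (M - m), M, by linarith, by linarith, fun i => ⟨?_, upper i⟩⟩
      have := key ((B ^ k) *ᵥ v - m • ((B ^ k) *ᵥ 1))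
        (fun i => by simpa using (hb i).1) (by simp; linarith) i
      rw [Matrix.mulVec_sub, Matrix.mulVec_smul, ← hstep, ← hstep] at this
      simp only [Pi.sub_apply, Pi.smul_apply, smul_eq_mul] at this
      linarith
    · refine ⟨m, M - δ * (M - m), by linarith, by linarith, fun i => ⟨lower i, ?_⟩⟩
      have := key (M • ((B ^ k) *ᵥ 1) - (B ^ k) *ᵥ v)
        (fun i => by simpa using (hb i).2) (by simp; linarith) i
      rw [Matrix.mulVec_sub, Matrix.mulVec_smul, ← hstep, ← hstep] at this
      simp only [Pi.sub_apply, Pi.smul_apply, smul_eq_mul] at this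
      linarith

/-- If no iterate of `v` under a positive matrix is nonnegative, then `v` is eventually dominated by
arbitrarily small multiples of the all-ones vector. -/
theorem exists_pow_mulVec_le_of_forall_not_nonneg [DecidableEq ι] [Nonempty ι] {B : Matrix ι ι ℝ}
    (hB : ∀ i j, 0 < B i j) (v : ι → ℝ) (hv : ∀ k : ℕ, ∃ i, ((B ^ k) *ᵥ v) i < 0)
    {ε : ℝ} (hε : 0 < ε) :
    ∃ k : ℕ, ∀ i, ((B ^ k) *ᵥ v) i ≤ ε * ((B ^ k) *ᵥ 1) i := by
  obtain ⟨q, D, hq0, hq1, h⟩ := exists_pow_mulVec_ratio_bounds hB v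
  have ht : Filter.Tendsto (fun k : ℕ => q ^ k * D) Filter.atTop (nhds 0) := by
    simpa using (tendsto_pow_atTop_nhds_zero_of_lt_one hq0 hq1).mul_const D
  obtain ⟨k, hk⟩ := (ht.eventually (gt_mem_nhds hε)).exists
  obtain ⟨m, M, -, hD, hb⟩ := h k
  obtain ⟨i, hi⟩ := hv k
  have hm : m < 0 := by
    by_contra! hm
    linarith [(hb i).1, mul_nonneg hm (pow_mulVec_one_pos hB k i).le]
  exact ⟨k, fun j => (hb j).2.trans
    (mul_le_mul_of_nonneg_right (by linarith) (pow_mulVec_one_pos hB k j).le)⟩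

end Matrix

/-! ### The limit as a lattice -/

namespace StationaryDimensionGroup

variable (E : StationaryDimensionGroup)

open Matrix

instance : Nonempty (Fin E.n) := ⟨⟨0, E.n_pos⟩⟩

theorem ofStage_add (i k : ℕ) (v : Fin E.n → ℤ) :
    E.ofStage (i + k) ((E.A ^ k) *ᵥ v) = E.ofStage i v := by
  have := AddCommGroup.DirectLimit.of_f (G := fun _ : ℕ => Fin E.n → ℤ) (f := E.bonding)
    (Nat.le_add_right i k) v
  simpa [bonding, ofStage] using this

/-- The limit is identified with the lattice at stage `0`. -/
def toLattice : E.Carrier →+ (Fin E.n → ℤ) :=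
  AddCommGroup.DirectLimit.lift _ _ _ (fun i => (Matrix.mulVecLin (E.A⁻¹ ^ i)).toAddMonoidHom) <| by
    intro i j hij x
    obtain ⟨k, rfl⟩ := Nat.exists_eq_add_of_le hij
    have h : E.A⁻¹ * E.A = 1 := Matrix.nonsing_inv_mul _ E.isUnit_det
    have h2 : E.A⁻¹ ^ k * E.A ^ k = 1 := by
      rw [← (show Commute E.A⁻¹ E.A from
        h.trans (Matrix.mul_nonsing_inv _ E.isUnit_det).symm).mul_pow, h, one_pow]
    simp only [bonding, LinearMap.toAddMonoidHom_coe, Nat.add_sub_cancel_left, Matrix.mulVecLin_apply,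
      Matrix.mulVec_mulVec, pow_add, mul_assoc, h2, mul_one]

theorem toLattice_ofStage_zero (v : Fin E.n → ℤ) : E.toLattice (E.ofStage 0 v) = v := by
  rw [toLattice, ofStage, AddCommGroup.DirectLimit.lift_of]
  simp

theorem ofStage_surjective (i : ℕ) : Function.Surjective (E.ofStage i) := by
  have hA (k : ℕ) : E.A ^ k * E.A⁻¹ ^ k = 1 := by
    rw [← (show Commute E.A E.A⁻¹ from
      (Matrix.mul_nonsing_inv _ E.isUnit_det).trans
        (Matrix.nonsing_inv_mul _ E.isUnit_det).symm).mul_pow,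
      Matrix.mul_nonsing_inv _ E.isUnit_det, one_pow]
  intro x
  induction x using AddCommGroup.DirectLimit.induction_on with
  | ih j v =>
  refine ⟨(E.A⁻¹ ^ j) *ᵥ ((E.A ^ i) *ᵥ v), ?_⟩
  have h1 := E.ofStage_add i j ((E.A⁻¹ ^ j) *ᵥ ((E.A ^ i) *ᵥ v))
  rw [Matrix.mulVec_mulVec, hA, Matrix.one_mulVec, add_comm i j, E.ofStage_add] at h1
  exact h1.symm

/-- The lattice at stage `0` is the whole limit. -/
def latticeEquiv : (Fin E.n → ℤ) ≃+ E.Carrier :=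
  AddEquiv.ofBijective (E.ofStage 0)
    ⟨Function.LeftInverse.injective E.toLattice_ofStage_zero, E.ofStage_surjective 0⟩

/-- Read through `latticeEquiv`, the stage map is a surjective endomorphism of a finitely generated
module, hence injective. -/
theorem ofStage_injective (i : ℕ) : Function.Injective (E.ofStage i) := by
  let f : (Fin E.n → ℤ) →ₗ[ℤ] (Fin E.n → ℤ) :=
    (E.latticeEquiv.symm.toAddMonoidHom.comp (E.ofStage i)).toIntLinearMap
  have hs : Function.Surjective f :=
    E.latticeEquiv.symm.surjective.comp (E.ofStage_surjective i)
  intro u v h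
  exact OrzechProperty.injective_of_surjective_endomorphism f hs (congrArg E.latticeEquiv.symm h)

instance : Module.Finite ℤ E.Carrier :=
  Module.Finite.equiv E.latticeEquiv.toIntLinearEquiv

variable {E}

theorem ofStage_mem_posCone {i : ℕ} {v : Fin E.n → ℤ} (hv : ∀ j, 0 ≤ v j) :
    E.ofStage i v ∈ E.posCone :=
  ⟨i, v, hv, rfl⟩

theorem zero_mem_posCone : (0 : E.Carrier) ∈ E.posCone :=
  ⟨0, 0, le_rfl, map_zero _⟩

theorem mulVec_pos_of_nonneg {v : Fin E.n → ℤ} (hv : 0 ≤ v) (hv0 : v ≠ 0) (i : Fin E.n) :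
    0 < (E.A *ᵥ v) i := by
  obtain ⟨j, hj⟩ := Function.ne_iff.mp hv0
  exact Finset.sum_pos' (fun l _ => mul_nonneg (E.pos i l).le (hv l))
    ⟨j, Finset.mem_univ j, mul_pos (E.pos i j) (lt_of_le_of_ne (hv j) (Ne.symm hj))⟩

/-! ### States, the order they determine, and scalars -/

namespace IsState

variable {τ : E.Carrier →+ ℝ}

/-- Every nonzero positive element is an order unit, so states are strictly positive on it. -/
theorem pos_of_mem (hτ : E.IsState τ) {x : E.Carrier} (hx : x ∈ E.posCone) (hx0 : x ≠ 0) :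
    0 < τ x := by
  refine lt_of_le_of_ne (hτ.2 x hx) fun h0 => hτ.1 ?_
  obtain ⟨i, v, hv, rfl⟩ := hx
  have hv0 : v ≠ 0 := by rintro rfl; exact hx0 (map_zero _)
  have hu := mulVec_pos_of_nonneg hv hv0
  have hxe : E.ofStage i v = E.ofStage (i + 1) (E.A *ᵥ v) := by
    rw [← E.ofStage_add i 1, pow_one]
  refine DFunLike.ext _ _ fun z => ?_
  obtain ⟨z, rfl⟩ := E.ofStage_surjective (i + 1) z
  -- The positive integer coordinates of `A v` are at least `1`, so both `N • A v ± z` are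
  -- nonnegative; if `τ` killed `A v`, it would kill `z`.
  obtain ⟨N, hN⟩ : ∃ N : ℕ, ∀ j, |z j| ≤ N := by
    obtain ⟨C, hC⟩ := (Set.finite_range fun j => |z j|).bddAbove
    exact ⟨C.toNat, fun j => (hC ⟨j, rfl⟩).trans (Int.self_le_toNat C)⟩
  have hb (j : Fin E.n) : |z j| ≤ N * (E.A *ᵥ v) j :=
    (hN j).trans (le_mul_of_one_le_right (by positivity) (hu j))
  have h1 : 0 ≤ τ (E.ofStage (i + 1) (N • (E.A *ᵥ v) - z)) :=
    hτ.2 _ (ofStage_mem_posCone fun j => by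
      simpa using (le_abs_self _).trans (hb j))
  have h2 : 0 ≤ τ (E.ofStage (i + 1) (N • (E.A *ᵥ v) + z)) :=
    hτ.2 _ (ofStage_mem_posCone fun j => by
      have := (neg_le_abs _).trans (hb j)
      simp only [Pi.add_apply, Pi.smul_apply, ← Nat.cast_smul_eq_nsmul ℤ, smul_eq_mul]
      linarith)
  rw [map_sub, map_sub, map_nsmul, map_nsmul, ← hxe, ← h0] at h1
  rw [map_add, map_add, map_nsmul, map_nsmul, ← hxe, ← h0] at h2
  simp only [smul_zero, zero_sub, zero_add, Left.nonneg_neg_iff] at h1 h2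
  exact le_antisymm h1 h2

/-- If no iterate of `v` were nonnegative, contraction would give `(N + 1) Aᵏ v ≤ Aᵏ 1` for some
`k`, whence `(N + 1) τ x ≤ τ 1`; this fails for large `N`. -/
theorem mem_of_pos (hτ : E.IsState τ) {x : E.Carrier} (hx : 0 < τ x) : x ∈ E.posCone := by
  obtain ⟨v, rfl⟩ := E.ofStage_surjective 0 x
  by_contra hmem
  set B : Matrix (Fin E.n) (Fin E.n) ℝ := E.A.map (Int.castRingHom ℝ) with hB
  have hcast (k : ℕ) (u : Fin E.n → ℤ) (i : Fin E.n) :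
      ((B ^ k) *ᵥ fun j => (u j : ℝ)) i = (((E.A ^ k) *ᵥ u) i : ℤ) := by
    have h1 := RingHom.map_mulVec (Int.castRingHom ℝ) (E.A ^ k) u i
    rw [Matrix.map_pow] at h1
    exact h1.symm
  have hBpos : ∀ i j, 0 < B i j := fun i j => by
    simpa [hB] using E.pos i j
  have hneg : ∀ k : ℕ, ∃ i, ((B ^ k) *ᵥ fun j => (v j : ℝ)) i < 0 := by
    intro k
    by_contra! hk
    apply hmem
    rw [← E.ofStage_add 0 k]
    refine ofStage_mem_posCone fun j => ?_
    have := hk j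
    rw [hcast] at this
    exact_mod_cast this
  obtain ⟨N, hN⟩ := exists_nat_gt (τ (E.ofStage 0 1) / τ (E.ofStage 0 v))
  rw [div_lt_iff₀ hx] at hN
  obtain ⟨k, hk⟩ := Matrix.exists_pow_mulVec_le_of_forall_not_nonneg hBpos _ hneg
    (show (0 : ℝ) < 1 / (N + 1) by positivity)
  have h1 : (1 : Fin E.n → ℝ) = fun j => (((1 : Fin E.n → ℤ) j : ℤ) : ℝ) := by ext; simp
  have h2 : 0 ≤ τ (E.ofStage (0 + k) ((E.A ^ k) *ᵥ 1 - (N + 1) • ((E.A ^ k) *ᵥ v))) := by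
    refine hτ.2 _ (ofStage_mem_posCone fun j => ?_)
    have := hk j
    rw [h1, hcast, hcast, one_div_mul_eq_div, le_div_iff₀ (by positivity)] at this
    have h3 : ((E.A ^ k) *ᵥ v) j * (N + 1) ≤ ((E.A ^ k) *ᵥ 1) j := by exact_mod_cast this
    simp only [Pi.sub_apply, Pi.smul_apply, ← Nat.cast_smul_eq_nsmul ℤ, smul_eq_mul]
    push_cast
    linarith
  rw [map_sub, map_sub, map_nsmul, map_nsmul, E.ofStage_add, E.ofStage_add, nsmul_eq_mul] at h2
  push_cast at h2
  linarith

/-- The order of a stationary dimension group is the strict order pulled back by any state. -/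
theorem mem_posCone_iff (hτ : E.IsState τ) (x : E.Carrier) :
    x ∈ E.posCone ↔ x = 0 ∨ 0 < τ x := by
  refine ⟨fun h => or_iff_not_imp_left.mpr (hτ.pos_of_mem h), ?_⟩
  rintro (rfl | h)
  exacts [zero_mem_posCone, hτ.mem_of_pos h]

theorem exists_pos (hτ : E.IsState τ) : ∃ x, 0 < τ x := by
  obtain ⟨x, hx⟩ := DFunLike.ne_iff.mp hτ.1
  rcases lt_or_gt_of_ne hx with h | h
  · exact ⟨-x, by simpa using h⟩
  · exact ⟨x, h⟩

/-- An additive map that is nonnegative on the positive cone is a multiple of any given state. -/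
theorem exists_eq_mul (hτ : E.IsState τ) {σ : E.Carrier →+ ℝ}
    (hσ : ∀ x ∈ E.posCone, 0 ≤ σ x) : ∃ c : ℝ, 0 ≤ c ∧ ∀ x, σ x = c * τ x := by
  obtain ⟨y, hy⟩ := hτ.exists_pos
  -- Otherwise a rational strictly between `σ x / σ y` and `τ x / τ y` gives an integer combination
  -- of `x` and `y` with `τ > 0`, hence in the cone, but `σ < 0`. If `σ y = 0`, adding multiples of
  -- `y` to `x` does the same.
  have key (x : E.Carrier) : σ y * τ x ≤ σ x * τ y := by
    by_contra! h
    have hσy : 0 < σ y := by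
      refine lt_of_le_of_ne (hσ y (hτ.mem_of_pos hy)) fun h0 => ?_
      rw [← h0, zero_mul] at h
      obtain ⟨N, hN⟩ := exists_nat_gt (-(τ x) / τ y)
      rw [div_lt_iff₀ hy] at hN
      have := hσ (x + N • y) (hτ.mem_of_pos (by rw [map_add, map_nsmul, nsmul_eq_mul]; linarith))
      rw [map_add, map_nsmul, ← h0, smul_zero, add_zero] at this
      nlinarith
    rw [mul_comm (σ y), ← div_lt_div_iff₀ hσy hy] at h
    obtain ⟨r, hr1, hr2⟩ := exists_rat_btwn h
    rw [Rat.cast_def] at hr1 hr2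
    have hd : (0 : ℝ) < r.den := by exact_mod_cast r.den_pos
    rw [div_lt_div_iff₀ hσy hd] at hr1
    rw [div_lt_div_iff₀ hd hy] at hr2
    have := hσ (r.den • x - r.num • y) (hτ.mem_of_pos (by
      rw [map_sub, map_nsmul, map_zsmul, nsmul_eq_mul, zsmul_eq_mul]; linarith))
    rw [map_sub, map_nsmul, map_zsmul, nsmul_eq_mul, zsmul_eq_mul] at this
    linarith
  refine ⟨σ y / τ y, div_nonneg (hσ y (hτ.mem_of_pos hy)) hy.le, fun x => ?_⟩
  have h1 := key x
  have h2 := key (-x)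
  rw [map_neg, map_neg] at h2
  field_simp
  linarith

theorem exists_pos_eq_mul (hτ : E.IsState τ) {σ : E.Carrier →+ ℝ} (hσ : E.IsState σ) :
    ∃ c : ℝ, 0 < c ∧ ∀ x, σ x = c * τ x := by
  obtain ⟨c, hc, h⟩ := hτ.exists_eq_mul hσ.2
  refine ⟨c, lt_of_le_of_ne hc ?_, h⟩
  rintro rfl
  exact hσ.1 (DFunLike.ext _ _ fun x => by simp [h x])

/-- All slopes are computed by any single state. -/
theorem mem_slopes_iff (hτ : E.IsState τ) {θ : ℝ} :
    θ ∈ E.slopes ↔ ∃ x y, τ y ≠ 0 ∧ θ = τ x / τ y := by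
  constructor
  · rintro ⟨σ, hσ, x, y, hy, rfl⟩
    obtain ⟨c, hc, h⟩ := hτ.exists_pos_eq_mul hσ
    rw [h y] at hy
    refine ⟨x, y, right_ne_zero_of_mul hy, ?_⟩
    rw [h x, h y, mul_div_mul_left _ _ hc.ne']
  · rintro ⟨x, y, hy, rfl⟩
    exact ⟨τ, hτ, x, y, hy, rfl⟩

/-- Rescaling of a state. -/
theorem smul (hτ : E.IsState τ) {c : ℝ} (hc : 0 < c) :
    E.IsState ((AddMonoidHom.mulLeft c).comp τ) := by
  obtain ⟨y, hy⟩ := hτ.exists_pos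
  refine ⟨fun h => ?_, fun x hx => mul_nonneg hc.le (hτ.2 x hx)⟩
  have := DFunLike.congr_fun h y
  exact (mul_pos hc hy).ne' this

/-- Order-endomorphisms act on a state by scalars. -/
theorem exists_scalar (hτ : E.IsState τ) (f : E.orderEnd) :
    ∃ c : ℝ, ∀ x, τ (f.1 x) = c * τ x := by
  obtain ⟨f, hf⟩ := f
  refine Subring.closure_induction (p := fun f _ => ∃ c : ℝ, ∀ x, τ (f x) = c * τ x)
    ?_ ?_ ?_ ?_ ?_ ?_ hf
  · intro g hg
    obtain ⟨c, -, h⟩ := hτ.exists_eq_mul (σ := τ.comp g) fun x hx => hτ.2 _ (hg x hx)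
    exact ⟨c, h⟩
  · exact ⟨0, fun x => by simp⟩
  · exact ⟨1, fun x => by simp⟩
  · rintro f g - - ⟨a, ha⟩ ⟨b, hb⟩
    exact ⟨a + b, fun x => by rw [show (f + g) x = f x + g x from rfl, map_add, ha, hb]; ring⟩
  · rintro f - ⟨a, ha⟩
    exact ⟨-a, fun x => by
      rw [show (-f) x = -(f x) from rfl, map_neg, ha]; ring⟩
  · rintro f g - - ⟨a, ha⟩ ⟨b, hb⟩
    exact ⟨a * b, fun x => by rw [show (f * g) x = f (g x) from rfl, ha, hb]; ring⟩

/-- The scalar by which an order-endomorphism acts on a state. -/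
def scalar (hτ : E.IsState τ) : E.orderEnd →+* ℝ where
  toFun f := (hτ.exists_scalar f).choose
  map_one' := by
    obtain ⟨y, hy⟩ := hτ.exists_pos
    have := (hτ.exists_scalar 1).choose_spec y
    refine mul_right_cancel₀ hy.ne' (this.symm.trans ?_)
    simp
  map_zero' := by
    obtain ⟨y, hy⟩ := hτ.exists_pos
    have := (hτ.exists_scalar 0).choose_spec y
    refine mul_right_cancel₀ hy.ne' (this.symm.trans ?_)
    simp
  map_mul' f g := by
    obtain ⟨y, hy⟩ := hτ.exists_pos
    have h1 := (hτ.exists_scalar (f * g)).choose_spec y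
    have h2 := (hτ.exists_scalar f).choose_spec (g.1 y)
    have h3 := (hτ.exists_scalar g).choose_spec y
    refine mul_right_cancel₀ hy.ne' (h1.symm.trans ?_)
    rw [mul_assoc, ← h3, ← h2]
    rfl
  map_add' f g := by
    obtain ⟨y, hy⟩ := hτ.exists_pos
    have h1 := (hτ.exists_scalar (f + g)).choose_spec y
    have h2 := (hτ.exists_scalar f).choose_spec y
    have h3 := (hτ.exists_scalar g).choose_spec y
    refine mul_right_cancel₀ hy.ne' (h1.symm.trans ?_)
    rw [add_mul, ← h3, ← h2, ← map_add]
    rfl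

theorem scalar_mul (hτ : E.IsState τ) (f : E.orderEnd) (x : E.Carrier) :
    hτ.scalar f * τ x = τ (f.1 x) :=
  ((hτ.exists_scalar f).choose_spec x).symm

theorem scalar_injective (hτ : E.IsState τ) (hinj : Function.Injective τ) :
    Function.Injective hτ.scalar := by
  intro f g h
  ext x
  apply hinj
  rw [← hτ.scalar_mul, ← hτ.scalar_mul, h]

/-- When the state is faithful, the order-endomorphisms are the multipliers of the image. -/
theorem mem_range_scalar_iff (hτ : E.IsState τ) (hinj : Function.Injective τ) {c : ℝ} :
    c ∈ Set.range hτ.scalar ↔ ∀ x, ∃ y, c * τ x = τ y := by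
  refine ⟨?_, fun h => ?_⟩
  · rintro ⟨f, rfl⟩ x
    exact ⟨f.1 x, hτ.scalar_mul f x⟩
  · choose g hg using h
    let f : AddMonoid.End E.Carrier :=
      { toFun := g
        map_zero' := hinj (by rw [← hg]; simp)
        map_add' := fun x y => hinj (by rw [← hg, map_add, map_add, ← hg, ← hg]; ring) }
    have hf (x : E.Carrier) : τ (f x) = c * τ x := (hg x).symm
    -- A negative multiplier does not preserve the cone, but `f + N` has the positive multiplier `c
    -- + N`, and `N` lies in the subring.
    obtain ⟨N, hN⟩ := exists_nat_gt (-c)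
    have hpos : f + N ∈ E.orderEnd := Subring.subset_closure fun x hx => by
      rw [hτ.mem_posCone_iff] at hx ⊢
      rcases hx with rfl | hx
      · left; simp
      · right
        have : (f + (N : AddMonoid.End E.Carrier)) x = f x + N • x := by
          rw [← AddMonoid.End.natCast_apply]; rfl
        rw [this, map_add, hf, map_nsmul, nsmul_eq_mul]
        nlinarith
    have hmem : f ∈ E.orderEnd := by
      simpa using E.orderEnd.sub_mem hpos (natCast_mem E.orderEnd N)
    obtain ⟨y, hy⟩ := hτ.exists_pos
    exact ⟨⟨f, hmem⟩, mul_right_cancel₀ hy.ne' ((hτ.scalar_mul _ y).trans (hf y))⟩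

/-- If the ring of order-endomorphisms is reduced then every state is faithful: an infinitesimal
element produces nilpotent order-endomorphisms. -/
theorem injective_of_isReduced [IsReduced E.orderEnd] (hτ : E.IsState τ) :
    Function.Injective τ := by
  rw [injective_iff_map_eq_zero]
  intro ν hν
  by_contra hν0
  obtain ⟨v, rfl⟩ := E.latticeEquiv.surjective ν
  have hv0 : v ≠ 0 := by rintro rfl; exact hν0 (map_zero _)
  obtain ⟨j, hj⟩ := Function.ne_iff.mp hv0
  simp only [Pi.zero_apply] at hj
  by_cases hn : ∃ i : Fin E.n, i ≠ j
  · obtain ⟨i, hij⟩ := hn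
    -- Since `φ v = 0`, the map `g = φ(·) v` squares to zero; since `τ` kills `v`, `1 + g` leaves
    -- `τ` unchanged and so preserves the cone.
    let φ : (Fin E.n → ℤ) →+ ℤ :=
      v j • Pi.evalAddMonoidHom _ i - v i • Pi.evalAddMonoidHom _ j
    have hφ (u : Fin E.n → ℤ) : φ u = v j * u i - v i * u j := by simp [φ]
    let g : AddMonoid.End E.Carrier :=
      ((smulAddHom ℤ E.Carrier).flip (E.latticeEquiv v)).comp
        (φ.comp E.latticeEquiv.symm.toAddMonoidHom)
    have hg (x : E.Carrier) : g x = φ (E.latticeEquiv.symm x) • E.latticeEquiv v := rfl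
    have h1 : 1 + g ∈ E.orderEnd := Subring.subset_closure fun x hx => by
      rw [hτ.mem_posCone_iff] at hx ⊢
      rcases hx with rfl | hx
      · left; simp
      · right
        rw [show (1 + g) x = x + g x from rfl, map_add, hg, map_zsmul, hν]
        simpa using hx
    have hmem : g ∈ E.orderEnd := by
      simpa using E.orderEnd.sub_mem h1 E.orderEnd.one_mem
    have hnil : IsNilpotent (⟨g, hmem⟩ : E.orderEnd) := by
      refine ⟨2, Subtype.ext ?_⟩
      ext x
      rw [pow_two]
      change g (g x) = 0
      rw [hg (g x), hg x, map_zsmul, E.latticeEquiv.symm_apply_apply, map_zsmul, hφ v]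
      have : v j * v i - v i * v j = 0 := by ring
      rw [this]; simp
    have h0 : g = 0 := congrArg Subtype.val hnil.eq_zero
    have := hg (E.latticeEquiv (Pi.single i 1))
    rw [h0, E.latticeEquiv.symm_apply_apply, ← map_zsmul, hφ] at this
    have h3 := (E.latticeEquiv.map_eq_zero_iff).mp this.symm
    have h4 := congrFun h3 j
    simp [Pi.single_eq_of_ne hij.symm, hj] at h4
  -- In rank one every vector is commensurable with `v`, so `τ` would vanish identically.
  · push Not at hn
    apply hτ.1
    refine DFunLike.ext _ _ fun x => ?_
    obtain ⟨u, rfl⟩ := E.latticeEquiv.surjective x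
    have : v j • u = u j • v := by
      ext i
      rw [hn i]
      simp [mul_comm]
    have h2 := congrArg (fun w => τ (E.latticeEquiv w)) this
    simp only [map_zsmul, hν, smul_zero] at h2
    exact (smul_eq_zero.mp h2).resolve_left hj

end IsState

/-! ### Morita equivalence as homothety, and states from eigenvectors -/

/-- Morita equivalence in terms of the images of faithful states. -/
theorem moritaEquiv_iff {F : StationaryDimensionGroup} {τ : E.Carrier →+ ℝ} {σ : F.Carrier →+ ℝ}
    (hτ : E.IsState τ) (hσ : F.IsState σ) (hτi : Function.Injective τ)
    (hσi : Function.Injective σ) :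
    MoritaEquiv E F ↔ ∃ c : ℝ, 0 < c ∧ Set.range σ = (c * ·) '' Set.range τ := by
  constructor
  · rintro ⟨e, he⟩
    have hst : E.IsState (σ.comp e.toAddMonoidHom) := by
      refine ⟨fun h => hσ.1 ?_, fun x hx => hσ.2 _ (he ▸ ⟨x, hx, rfl⟩)⟩
      refine DFunLike.ext _ _ fun y => ?_
      simpa using DFunLike.congr_fun h (e.symm y)
    obtain ⟨c, hc, h⟩ := hτ.exists_pos_eq_mul hst
    refine ⟨c, hc, ?_⟩
    rw [← Set.range_comp, ← e.surjective.range_comp σ]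
    exact congrArg Set.range (funext h)
  · rintro ⟨c, hc, h⟩
    rw [← Set.range_comp] at h
    have hmem (x : E.Carrier) : ∃ y, σ y = c * τ x := by
      have : c * τ x ∈ Set.range σ := h ▸ ⟨x, rfl⟩
      exact this
    choose g hg using hmem
    have hbij : Function.Bijective g := by
      refine ⟨fun x y hxy => hτi ?_, fun y => ?_⟩
      · have h1 := hg x
        rw [hxy, hg y] at h1
        exact (mul_left_cancel₀ hc.ne' h1).symm
      · obtain ⟨x, hx⟩ : σ y ∈ Set.range ((c * ·) ∘ τ) := h ▸ ⟨y, rfl⟩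
        exact ⟨x, hσi ((hg x).trans hx)⟩
    let e : E.Carrier ≃+ F.Carrier := AddEquiv.ofBijective
      ({ toFun := g
         map_zero' := hσi (by rw [hg]; simp)
         map_add' := fun x y => hσi (by rw [hg, map_add, map_add, hg, hg]; ring) } :
          E.Carrier →+ F.Carrier) hbij
    have he (x : E.Carrier) : σ (e x) = c * τ x := hg x
    refine ⟨e, Set.ext fun y => ?_⟩
    obtain ⟨x, rfl⟩ := e.surjective y
    rw [e.injective.mem_set_image, hτ.mem_posCone_iff, hσ.mem_posCone_iff, he,
      e.map_eq_zero_iff, mul_pos_iff_of_pos_left hc]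

theorem moritaClass_eq_iff {F : StationaryDimensionGroup} :
    E.moritaClass = F.moritaClass ↔ MoritaEquiv E F :=
  Quotient.eq (r := moritaSetoid)

/-- A positive left eigenvector of the incidence matrix defines a state. -/
theorem exists_isState_of_vecMul_eq {w : Fin E.n → ℝ} {r : ℝ} (hr : 0 < r) (hw : ∀ i, 0 < w i)
    (h : ∀ j, ∑ i, w i * E.A i j = r * w j) :
    ∃ τ : E.Carrier →+ ℝ, E.IsState τ ∧ ∀ v, τ (E.latticeEquiv v) = ∑ i, w i * v i := by
  let g : (Fin E.n → ℤ) →+ ℝ :=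
    { toFun := fun v => ∑ i, w i * v i
      map_zero' := by simp
      map_add' := fun u v => by simp [mul_add, Finset.sum_add_distrib] }
  have hgA (v : Fin E.n → ℤ) : g (E.A *ᵥ v) = r * g v := by
    change ∑ i, w i * ((∑ j, E.A i j * v j : ℤ) : ℝ) = r * ∑ i, w i * v i
    simp only [Int.cast_sum, Int.cast_mul, Finset.mul_sum]
    rw [Finset.sum_comm]
    refine Finset.sum_congr rfl fun j _ => ?_
    rw [← mul_assoc, ← h, Finset.sum_mul]
    exact Finset.sum_congr rfl fun i _ => by ring
  have hgk (k : ℕ) (v : Fin E.n → ℤ) : g ((E.A ^ k) *ᵥ v) = r ^ k * g v := by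
    induction k with
    | zero => simp
    | succ k ih => rw [pow_succ', ← Matrix.mulVec_mulVec, hgA, ih]; ring
  let τ : E.Carrier →+ ℝ := g.comp E.latticeEquiv.symm.toAddMonoidHom
  have hτ (v : Fin E.n → ℤ) : τ (E.latticeEquiv v) = g v := by simp [τ]
  refine ⟨τ, ⟨fun h0 => ?_, ?_⟩, hτ⟩
  · have := hτ 1
    rw [h0] at this
    have hp : 0 < g 1 := by
      change 0 < ∑ i, w i * ((1 : ℤ) : ℝ)
      exact Finset.sum_pos (fun i _ => by simpa using hw i) Finset.univ_nonempty
    exact hp.ne this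
  · rintro x ⟨i, v, hv, rfl⟩
    -- Pulling stage `i` back to stage `0` divides `g` by `rⁱ > 0`, so nonnegativity survives.
    obtain ⟨u, hu⟩ := E.latticeEquiv.surjective (E.ofStage i v)
    have hz := E.ofStage_add 0 i u
    rw [zero_add] at hz
    have h2 : (E.A ^ i) *ᵥ u = v := E.ofStage_injective i (hz.trans hu)
    rw [← hu, hτ]
    have h3 := hgk i u
    rw [h2] at h3
    have h4 : 0 ≤ g v := Finset.sum_nonneg (s := Finset.univ) (f := fun j => w j * (v j : ℝ)) fun j _ =>
      mul_nonneg (hw j).le (Int.cast_nonneg (hv j))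
    rw [h3] at h4
    exact nonneg_of_mul_nonneg_right h4 (pow_pos hr i)

end StationaryDimensionGroup

/-! ### Arithmetic of the real quadratic field -/

namespace RealQuadratic

variable {d : ℕ}

theorem sqrt_mem (d : ℕ) : Real.sqrt d ∈ realQuadraticField d :=
  IntermediateField.mem_adjoin_simple_self ℚ _

theorem isIntegral_sqrt (R : Type*) [CommRing R] [Algebra R ℝ] : IsIntegral R (Real.sqrt d) := by
  refine IsIntegral.of_pow two_pos ?_
  rw [Real.sq_sqrt (Nat.cast_nonneg d), ← map_natCast (algebraMap R ℝ)]
  exact isIntegral_algebraMap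

theorem irrational_sqrt (hd : Squarefree d) (hd1 : 1 < d) : Irrational (Real.sqrt d) := by
  rw [irrational_sqrt_natCast_iff]
  rintro ⟨a, rfl⟩
  have := Nat.isUnit_iff.mp (hd a dvd_rfl)
  simp [this] at hd1

theorem minpoly_sqrt (hd : Squarefree d) (hd1 : 1 < d) :
    minpoly ℚ (Real.sqrt d) = Polynomial.X ^ 2 - Polynomial.C (d : ℚ) := by
  symm
  apply minpoly.eq_of_irreducible_of_monic
  · refine (Polynomial.irreducible_iff_roots_eq_zero_of_degree_le_three ?_ ?_).mpr ?_
    · rw [Polynomial.natDegree_X_pow_sub_C]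
    · rw [Polynomial.natDegree_X_pow_sub_C]; norm_num
    · refine Multiset.eq_zero_of_forall_notMem fun r hr => ?_
      have h := (Polynomial.mem_roots'.mp hr).2
      simp only [Polynomial.IsRoot, Polynomial.eval_sub, Polynomial.eval_pow, Polynomial.eval_X,
        Polynomial.eval_C, sub_eq_zero] at h
      refine irrational_sqrt hd hd1 ⟨|r|, ?_⟩
      rw [← Rat.cast_natCast, ← h, Rat.cast_pow, Real.sqrt_sq_eq_abs, Rat.cast_abs]
  · simp
  · exact Polynomial.monic_X_pow_sub_C _ two_ne_zero

/-- The nontrivial real embedding. -/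
theorem exists_conj (hd : Squarefree d) (hd1 : 1 < d) :
    ∃ σ : realQuadraticField d →ₐ[ℚ] ℝ, σ ⟨Real.sqrt d, sqrt_mem d⟩ = -Real.sqrt d := by
  let σ : realQuadraticField d →ₐ[ℚ] ℝ :=
    (IntermediateField.algHomAdjoinIntegralEquiv ℚ (isIntegral_sqrt ℚ)).symm ⟨-Real.sqrt d, by
      rw [Polynomial.mem_aroots, minpoly_sqrt hd hd1]
      refine ⟨(Polynomial.monic_X_pow_sub_C _ two_ne_zero).ne_zero, ?_⟩
      simp⟩
  exact ⟨σ, IntermediateField.algHomAdjoinIntegralEquiv_symm_apply_gen ℚ _ _⟩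

theorem finrank_eq (hd : Squarefree d) (hd1 : 1 < d) :
    Module.finrank ℚ (realQuadraticField d) = 2 := by
  have := IntermediateField.adjoin.finrank (K := ℚ) (x := Real.sqrt d) (isIntegral_sqrt ℚ)
  rw [minpoly_sqrt hd hd1, Polynomial.natDegree_X_pow_sub_C] at this
  exact this

theorem exists_rat_eq (hd : Squarefree d) (hd1 : 1 < d) (x : realQuadraticField d) :
    ∃ a b : ℚ, x = algebraMap ℚ _ a * ⟨Real.sqrt d, sqrt_mem d⟩ + algebraMap ℚ _ b := by
  let pb : PowerBasis ℚ (realQuadraticField d) :=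
    IntermediateField.adjoin.powerBasis (isIntegral_sqrt (d := d) ℚ)
  have hdim : pb.dim = 2 := by rw [← pb.finrank, finrank_eq hd hd1]
  obtain ⟨f, hf, hx⟩ := pb.exists_eq_aeval x
  rw [hdim] at hf
  obtain ⟨a, b, rfl⟩ := Polynomial.exists_eq_X_add_C_of_natDegree_le_one (Nat.lt_succ_iff.mp hf)
  refine ⟨a, b, ?_⟩
  rw [hx]
  simp only [map_add, map_mul, Polynomial.aeval_C, Polynomial.aeval_X]
  rfl

/-- The inclusion of the ring of integers into `ℝ`. -/
def incl (d : ℕ) : 𝓞 (realQuadraticField d) →+* ℝ :=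
  (algebraMap (realQuadraticField d) ℝ).comp (algebraMap _ _)

theorem incl_injective : Function.Injective (incl d) :=
  (algebraMap (realQuadraticField d) ℝ).injective.comp NumberField.RingOfIntegers.coe_injective

theorem incl_mem (x : 𝓞 (realQuadraticField d)) : incl d x ∈ realQuadraticField d :=
  (algebraMap (𝓞 (realQuadraticField d)) (realQuadraticField d) x).2

theorem exists_incl_eq {x : ℝ} (hx : x ∈ realQuadraticField d) (hint : IsIntegral ℤ x) :
    ∃ y, incl d y = x := by
  refine ⟨⟨⟨x, hx⟩, ?_⟩, rfl⟩
  exact (isIntegral_algHom_iff ((realQuadraticField d).val.restrictScalars ℤ)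
    (realQuadraticField d).val.injective).mp hint

/-- The other embedding of the ring of integers, given by conjugation, together with the integrality
of the norm. -/
theorem exists_conj_incl (hd : Squarefree d) (hd1 : 1 < d) :
    ∃ κ : 𝓞 (realQuadraticField d) →+* ℝ, Function.Injective κ ∧
      (∀ x, incl d x = Real.sqrt d → κ x = -Real.sqrt d) ∧
      ∀ x, ∃ N : ℤ, incl d x * κ x = N := by
  obtain ⟨σ, hσ⟩ := exists_conj hd hd1
  refine ⟨σ.toRingHom.comp (algebraMap _ _),
    σ.toRingHom.injective.comp NumberField.RingOfIntegers.coe_injective, ?_, ?_⟩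
  · intro x hx
    rw [← hσ]
    exact congrArg σ (Subtype.ext hx)
  · intro x
    have hint1 : IsIntegral ℤ (incl d x) := x.isIntegral.map (incl d).toIntAlgHom
    have hint2 : IsIntegral ℤ ((σ.toRingHom.comp (algebraMap (𝓞 (realQuadraticField d)) _)) x) :=
      x.isIntegral.map (σ.toRingHom.comp (algebraMap _ _)).toIntAlgHom
    obtain ⟨a, b, hab⟩ := exists_rat_eq hd hd1 (x : realQuadraticField d)
    have h1 : incl d x = a * Real.sqrt d + b := by
      have := congrArg (algebraMap (realQuadraticField d) ℝ) hab
      exact this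
    have h2 : (σ.toRingHom.comp (algebraMap (𝓞 (realQuadraticField d)) _)) x =
        a * (-Real.sqrt d) + b := by
      have := congrArg σ hab
      rw [map_add, map_mul, hσ, σ.commutes, σ.commutes] at this
      exact this
    have hprod := hint1.mul hint2
    have hq : incl d x * (σ.toRingHom.comp (algebraMap (𝓞 (realQuadraticField d)) _)) x =
        algebraMap ℚ ℝ (b ^ 2 - a ^ 2 * d) := by
      have hs := Real.mul_self_sqrt (Nat.cast_nonneg (α := ℝ) d)
      rw [h1, h2, eq_ratCast]
      push_cast
      linear_combination (-(a : ℝ) ^ 2) * hs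
    rw [hq] at hprod
    have hz := (isIntegral_algebraMap_iff (algebraMap ℚ ℝ).injective).mp hprod
    obtain ⟨N, hN⟩ := IsIntegrallyClosed.isIntegral_iff.mp hz
    refine ⟨N, hq.trans ?_⟩
    rw [← hN]
    simp

/-- A nontrivial Pell solution gives `|x| + |y| √d`, the absolute values making it larger than `1`.
Its norm is `1`, so its conjugate is its inverse and tends to zero under powers. -/
theorem exists_unit (hd : Squarefree d) (hd1 : 1 < d) {κ : 𝓞 (realQuadraticField d) →+* ℝ}
    (hκ : ∀ x, incl d x = Real.sqrt d → κ x = -Real.sqrt d) :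
    ∃ ε : (𝓞 (realQuadraticField d))ˣ, 1 < incl d ε ∧ incl d ε * κ ε = 1 := by
  obtain ⟨ω, hω⟩ := exists_incl_eq (sqrt_mem d) (isIntegral_sqrt ℤ)
  have hsq : ¬ IsSquare (d : ℤ) := by
    rw [Int.isSquare_natCast_iff]
    exact irrational_sqrt_natCast_iff.mp (irrational_sqrt hd hd1)
  obtain ⟨x, y, hxy, hy⟩ := Pell.exists_of_not_isSquare (by omega : (0 : ℤ) < d) hsq
  have hωω : ω * ω = (d : 𝓞 (realQuadraticField d)) := incl_injective <| by
    rw [map_mul, hω, map_natCast, Real.mul_self_sqrt (Nat.cast_nonneg d)]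
  have habs : (|x| : ℤ) ^ 2 - d * (|y| : ℤ) ^ 2 = 1 := by rwa [sq_abs, sq_abs]
  have hone : ((|x| : ℤ) + (|y| : ℤ) * ω) * ((|x| : ℤ) - (|y| : ℤ) * ω) = 1 := by
    have h := congrArg (Int.cast : ℤ → 𝓞 (realQuadraticField d)) habs
    push_cast at h
    linear_combination h - ((|y| : ℤ) : 𝓞 (realQuadraticField d)) ^ 2 * hωω
  refine ⟨⟨_, _, hone, (mul_comm _ _).trans hone⟩, ?_, ?_⟩
  · have hs : 1 < Real.sqrt d := by
      rw [Real.lt_sqrt zero_le_one]; exact_mod_cast (by simpa using hd1)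
    have h1 : (1 : ℝ) ≤ (|y| : ℤ) := by exact_mod_cast Int.one_le_abs hy
    have h2 : (0 : ℝ) ≤ (|x| : ℤ) := by exact_mod_cast abs_nonneg x
    simp only [map_add, map_mul, map_intCast, hω]
    nlinarith
  · have h := congrArg (Int.cast : ℤ → ℝ) habs
    simp only [map_add, map_mul, map_intCast, hω, hκ ω hω]
    push_cast at h ⊢
    have hs := Real.mul_self_sqrt (Nat.cast_nonneg (α := ℝ) d)
    linear_combination h - |(y : ℝ)| ^ 2 * hs

end RealQuadratic

/-! ### Ideal bases with prescribed signs -/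

namespace Module.Basis

/-- A step of the Euclidean algorithm on bases of a lattice of rank two. -/
theorem exists_euclid_step {M : Type*} [AddCommGroup M] (b : Module.Basis (Fin 2) ℤ M) (k : ℤ) :
    ∃ b' : Module.Basis (Fin 2) ℤ M, b' 0 = b 1 - k • b 0 ∧ b' 1 = b 0 := by
  let f : M →ₗ[ℤ] M := b.constr ℤ ![b 1 - k • b 0, b 0]
  let g : M →ₗ[ℤ] M := b.constr ℤ ![b 1, b 0 + k • b 1]
  have hf0 : f (b 0) = b 1 - k • b 0 := b.constr_basis ℤ _ 0
  have hf1 : f (b 1) = b 0 := b.constr_basis ℤ _ 1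
  have hg0 : g (b 0) = b 1 := b.constr_basis ℤ _ 0
  have hg1 : g (b 1) = b 0 + k • b 1 := b.constr_basis ℤ _ 1
  have hfg : f ∘ₗ g = LinearMap.id := b.ext fun i => by
    fin_cases i
    · simp [hf1, hg0]
    · simp [hf0, hf1, hg1]
  have hgf : g ∘ₗ f = LinearMap.id := b.ext fun i => by
    fin_cases i
    · simp [hf0, hg0, hg1]
    · simp [hf1, hg0]
  exact ⟨b.map (LinearEquiv.ofLinearMap f g hfg hgf), hf0, hf1⟩

end Module.Basis

namespace RealQuadratic

variable {d : ℕ}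

/-- Every nonzero ideal has a `ℤ`-basis of positive numbers whose conjugates have opposite signs. -/
theorem exists_basis_sign (hd : Squarefree d) (hd1 : 1 < d) {κ : 𝓞 (realQuadraticField d) →+* ℝ}
    (hκi : Function.Injective κ) (hN : ∀ x, ∃ N : ℤ, incl d x * κ x = N)
    (I : Ideal (𝓞 (realQuadraticField d))) (hI : I ≠ ⊥) :
    ∃ b : Module.Basis (Fin 2) ℤ I, (∀ i, 0 < incl d (b i)) ∧ κ (b 0) < 0 ∧ 0 < κ (b 1) := by
  choose N hN using hN
  have hne : Nonempty (Module.Basis (Fin 2) ℤ I) := by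
    have h2 : Module.finrank ℤ (𝓞 (realQuadraticField d)) = 2 := by
      rw [NumberField.RingOfIntegers.rank, finrank_eq hd hd1]
    exact ⟨Ideal.selfBasis (Module.finBasisOfFinrankEq ℤ _ h2) I hI⟩
  -- Minimality of the norm of the first basis vector replaces running the Euclidean algorithm to
  -- its end.
  obtain ⟨b, hb⟩ : ∃ b : Module.Basis (Fin 2) ℤ I, ∀ b' : Module.Basis (Fin 2) ℤ I,
      (N (b 0)).natAbs ≤ (N (b' 0)).natAbs :=
    ⟨Function.argmin (fun b : Module.Basis (Fin 2) ℤ I => (N (b 0)).natAbs),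
      fun b' => Function.argmin_le (fun b : Module.Basis (Fin 2) ℤ I => (N (b 0)).natAbs) b'⟩
  have hi (c : Module.Basis (Fin 2) ℤ I) (i : Fin 2) : incl d (c i) ≠ 0 :=
    (map_ne_zero_iff _ incl_injective).mpr fun h => c.ne_zero i (Subtype.ext h)
  have hk (c : Module.Basis (Fin 2) ℤ I) (i : Fin 2) : κ (c i) ≠ 0 :=
    (map_ne_zero_iff _ hκi).mpr fun h => c.ne_zero i (Subtype.ext h)
  have hstep (k : ℤ) : ∃ b' : Module.Basis (Fin 2) ℤ I, b' 1 = b 0 ∧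
      incl d (b' 0) = (incl d (b 1) / incl d (b 0) - k) * incl d (b 0) ∧
      κ (b' 0) = (κ (b 1) / κ (b 0) - k) * κ (b 0) := by
    obtain ⟨b', h0, h1⟩ := b.exists_euclid_step k
    refine ⟨b', h1, ?_, ?_⟩
    · rw [h0, sub_mul, div_mul_cancel₀ _ (hi b 0)]
      simp
    · rw [h0, sub_mul, div_mul_cancel₀ _ (hk b 0)]
      simp
  set t := incl d (b 1) / incl d (b 0) with ht
  set t' := κ (b 1) / κ (b 0) with ht'
  have hirr (k : ℤ) : t - k ≠ 0 ∧ t' - k ≠ 0 := by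
    obtain ⟨b', -, h2, h3⟩ := hstep k
    exact ⟨left_ne_zero_of_mul (h2 ▸ hi b' 0), left_ne_zero_of_mul (h3 ▸ hk b' 0)⟩
  -- An integer separating the ratio `t` from its conjugate `t'` makes the norms of the new basis
  -- vectors opposite in sign. With equal floors, both fractional parts lie in `(0, 1)` and the step
  -- would produce a smaller norm.
  obtain ⟨k, hk0⟩ : ∃ k : ℤ, (t - k) * (t' - k) < 0 := by
    have pos (s : ℝ) (hs : s - ⌊s⌋ ≠ 0) : 0 < s - ⌊s⌋ :=
      lt_of_le_of_ne (sub_nonneg.mpr (Int.floor_le s)) hs.symm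
    rcases lt_trichotomy ⌊t⌋ ⌊t'⌋ with h | h | h
    · refine ⟨⌊t'⌋, mul_neg_of_neg_of_pos ?_ (pos _ (hirr _).2)⟩
      exact sub_neg.mpr (Int.floor_lt.mp h)
    · exfalso
      obtain ⟨b', -, h2, h3⟩ := hstep ⌊t⌋
      have p1 := pos _ (hirr ⌊t⌋).1
      have p2 := pos _ (hirr ⌊t'⌋).2
      have q1 := Int.lt_floor_add_one t
      have q2 := Int.lt_floor_add_one t'
      rw [← h] at p2 q2
      have e : (N (b' 0) : ℝ) = (t - ⌊t⌋) * (t' - ⌊t⌋) * N (b 0) := by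
        rw [← hN, ← hN, h2, h3]; ring
      have hle : |(N (b 0) : ℝ)| ≤ |(N (b' 0) : ℝ)| := by
        have := hb b'
        rw [← Int.cast_abs, ← Int.cast_abs, Int.cast_le, Int.abs_eq_natAbs, Int.abs_eq_natAbs]
        exact_mod_cast this
      rw [e, abs_mul, abs_of_pos (mul_pos p1 p2)] at hle
      have hpos : 0 < |(N (b 0) : ℝ)| := by
        rw [← hN]; exact abs_pos.mpr (mul_ne_zero (hi b 0) (hk b 0))
      have hlt : (t - ⌊t⌋) * (t' - ⌊t⌋) < 1 := by nlinarith
      nlinarith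
    · refine ⟨⌊t⌋, mul_neg_of_pos_of_neg (pos _ (hirr _).1) ?_⟩
      exact sub_neg.mpr (Int.floor_lt.mp h)
  obtain ⟨b', h1, h2, h3⟩ := hstep k
  have hsign : (incl d (b' 0) * κ (b' 0)) * (incl d (b' 1) * κ (b' 1)) < 0 := by
    rw [h1, h2, h3, show (t - k) * incl d (b 0) * ((t' - k) * κ (b 0)) * (incl d (b 0) * κ (b 0)) =
      (t - k) * (t' - k) * (incl d (b 0) * κ (b 0)) ^ 2 by ring]
    exact mul_neg_of_neg_of_pos hk0 (sq_pos_of_ne_zero (mul_ne_zero (hi b 0) (hk b 0)))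
  -- Changing signs of basis vectors leaves their norms alone, so positivity can be arranged and the
  -- conjugates then have opposite signs.
  have hunit (i : Fin 2) : ∃ u : ℤˣ, 0 < ((u : ℤ) : ℝ) * incl d (b' i) := by
    rcases lt_or_gt_of_ne (hi b' i) with h | h
    · exact ⟨-1, by simpa using h⟩
    · exact ⟨1, by simpa using h⟩
  choose u hu using hunit
  let c := b'.unitsSMul u
  have hc (i : Fin 2) : ((c i : I) : 𝓞 (realQuadraticField d)) = ((u i : ℤ) : 𝓞 (realQuadraticField d)) * b' i := by
    rw [Module.Basis.unitsSMul_apply, Units.smul_def]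
    simp
  have hci (i : Fin 2) : 0 < incl d (c i) := by
    rw [hc, map_mul, map_intCast]; exact hu i
  have hcs : κ (c 0) * κ (c 1) < 0 := by
    have hsq (i : Fin 2) : (((u i : ℤ) : ℝ)) ^ 2 = 1 := by
      rcases Int.units_eq_one_or (u i) with h | h <;> simp [h]
    have : (incl d (c 0) * κ (c 0)) * (incl d (c 1) * κ (c 1)) < 0 := by
      rw [hc, hc, map_mul, map_mul, map_mul, map_mul, map_intCast, map_intCast, map_intCast,
        map_intCast]
      convert hsign using 1
      linear_combination (((u 1 : ℤ) : ℝ) ^ 2 * hsq 0 + hsq 1) *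
        ((incl d (b' 0) * κ (b' 0)) * (incl d (b' 1) * κ (b' 1)))
    rw [mul_mul_mul_comm] at this
    exact neg_of_mul_neg_right this (mul_pos (hci 0) (hci 1)).le
  rcases mul_neg_iff.mp hcs with ⟨p, q⟩ | ⟨p, q⟩
  · refine ⟨c.reindex (Equiv.swap 0 1), fun i => ?_, ?_, ?_⟩
    · rw [Module.Basis.reindex_apply]; exact hci _
    · simpa using q
    · simpa using p
  · exact ⟨c, hci, p, q⟩

end RealQuadratic

/-! ### Realizing ideals by positive matrices -/

namespace RealQuadratic

variable {d : ℕ}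

open Filter in
/-- A positive real number whose powers dominate makes the coordinates positive. -/
theorem exists_pow_dominates {p : ℝ} (hp : 1 < p) {ι : Type*} [Finite ι] (a c : ι → ℝ)
    (ha : ∀ i, 0 < a i) : ∃ k : ℕ, ∀ i, 0 < p ^ k * a i - (p ^ k)⁻¹ * c i := by
  have h (i : ι) : ∀ᶠ k : ℕ in atTop, |c i| < p ^ k * a i :=
    ((tendsto_pow_atTop_atTop_of_one_lt hp).atTop_mul_const (ha i)).eventually_gt_atTop _
  obtain ⟨k, hk⟩ := (eventually_all.mpr h).exists
  refine ⟨k, fun i => ?_⟩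
  have h1 : (p ^ k)⁻¹ ≤ 1 := inv_le_one_of_one_le₀ (one_le_pow₀ hp.le)
  have h0 : 0 < (p ^ k)⁻¹ := by positivity
  have h2 : (p ^ k)⁻¹ * c i ≤ |c i| :=
    (mul_le_mul_of_nonneg_left (le_abs_self _) h0.le).trans
      (mul_le_of_le_one_left (abs_nonneg _) h1)
  linarith [hk i]

/-- Every nonzero ideal of a real quadratic field is the image of a faithful state of a stationary
dimension group. -/
theorem exists_stationaryDimensionGroup (hd : Squarefree d) (hd1 : 1 < d)
    (I : Ideal (𝓞 (realQuadraticField d))) (hI : I ≠ ⊥) :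
    ∃ (E : StationaryDimensionGroup) (τ : E.Carrier →+ ℝ), E.IsState τ ∧
      Function.Injective τ ∧ Set.range τ = incl d '' I := by
  obtain ⟨κ, hκi, hκ, hN⟩ := exists_conj_incl hd hd1
  obtain ⟨ε, hε1, hε⟩ := exists_unit hd hd1 hκ
  obtain ⟨b, hb, hb0, hb1⟩ := exists_basis_sign hd hd1 hκi hN I hI
  set Δ := incl d (b 0) * κ (b 1) - κ (b 0) * incl d (b 1) with hΔ
  have hΔ0 : 0 < Δ := by nlinarith [mul_pos (hb 0) hb1, mul_pos (neg_pos.mpr hb0) (hb 1)]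
  -- By Cramer's rule over the two embeddings, each entry of the matrix of `εᵏ`, times `Δ`, is `εᵏ`
  -- times a positive number minus `ε⁻ᵏ` times another number; the signs of the basis make the first
  -- factor positive.
  obtain ⟨k, hk⟩ := exists_pow_dominates hε1
    (fun i : Fin 2 × Fin 2 => incl d (b i.2) * ![κ (b 1), -κ (b 0)] i.1)
    (fun i : Fin 2 × Fin 2 => κ (b i.2) * ![incl d (b 1), -incl d (b 0)] i.1) (by
      rintro ⟨i, j⟩
      refine mul_pos (hb j) ?_
      fin_cases i
      · exact hb1
      · exact neg_pos.mpr hb0)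
  have hκε : κ ((ε ^ k : (𝓞 (realQuadraticField d))ˣ) : 𝓞 _) = (incl d ε ^ k)⁻¹ := by
    rw [Units.val_pow_eq_pow_val, map_pow, ← inv_pow, eq_inv_of_mul_eq_one_right hε]
  have hιε : incl d ((ε ^ k : (𝓞 (realQuadraticField d))ˣ) : 𝓞 _) = incl d ε ^ k := by
    rw [Units.val_pow_eq_pow_val, map_pow]
  have hinv : (0 : ℝ) < incl d ε ^ k := by positivity
  let f : I ≃ₗ[ℤ] I := DistribMulAction.toLinearEquiv ℤ I (ε ^ k)
  let A : Matrix (Fin 2) (Fin 2) ℤ := LinearMap.toMatrix b b f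
  have hA (j : Fin 2) : ((ε ^ k : (𝓞 (realQuadraticField d))ˣ) : 𝓞 (realQuadraticField d)) * b j =
      (A 0 j : 𝓞 (realQuadraticField d)) * b 0 + (A 1 j : 𝓞 (realQuadraticField d)) * b 1 := by
    have h := b.sum_repr (f (b j))
    rw [Fin.sum_univ_two] at h
    have h2 := congrArg (Subtype.val : I → 𝓞 (realQuadraticField d)) h
    simp only [Submodule.coe_add, Submodule.coe_smul_of_tower, zsmul_eq_mul] at h2
    simp only [A, LinearMap.toMatrix_apply]
    exact h2.symm
  have hAι (j : Fin 2) : incl d ε ^ k * incl d (b j) =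
      A 0 j * incl d (b 0) + A 1 j * incl d (b 1) := by
    have := congrArg (incl d) (hA j)
    simpa only [map_mul, map_add, map_intCast, hιε] using this
  have hAκ (j : Fin 2) : (incl d ε ^ k)⁻¹ * κ (b j) = A 0 j * κ (b 0) + A 1 j * κ (b 1) := by
    have := congrArg κ (hA j)
    simpa only [map_mul, map_add, map_intCast, hκε] using this
  have hpos : ∀ i j, 0 < A i j := by
    intro i j
    have h : 0 < (A i j : ℝ) * Δ := by
      refine (hk (i, j)).trans_eq ?_
      fin_cases i
      · simp only [Fin.zero_eta, Matrix.cons_val_zero, hΔ]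
        linear_combination κ (b 1) * hAι j - incl d (b 1) * hAκ j
      · simp only [Fin.mk_one, Matrix.cons_val_one, Matrix.cons_val_fin_one, hΔ]
        linear_combination (-κ (b 0)) * hAι j + incl d (b 0) * hAκ j
    exact_mod_cast (pos_of_mul_pos_left h hΔ0.le)
  let E : StationaryDimensionGroup := ⟨2, two_pos, A, LinearEquiv.isUnit_det f b b, hpos⟩
  obtain ⟨τ, hτ, hτv⟩ := StationaryDimensionGroup.exists_isState_of_vecMul_eq (E := E)
    (w := fun i : Fin 2 => incl d (b i)) hinv hb (fun j => by
      refine (Fin.sum_univ_two _).trans ((hAι j).symm ▸ ?_)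
      change incl d (b 0) * (A 0 j : ℝ) + incl d (b 1) * (A 1 j : ℝ) = _
      ring)
  have hτb (v : Fin 2 → ℤ) : τ (E.latticeEquiv v) = incl d (b.equivFun.symm v) := by
    refine (hτv v).trans ?_
    rw [b.equivFun_symm_apply]
    change ∑ i : Fin 2, incl d (b i) * (v i : ℝ) = _
    simp [Fin.sum_univ_two, mul_comm]
  have hτe : (τ : E.Carrier → ℝ) =
      fun x => incl d (b.equivFun.symm (E.latticeEquiv.symm x)) := funext fun x => by
    rw [← hτb, AddEquiv.apply_symm_apply]
  refine ⟨E, τ, hτ, ?_, ?_⟩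
  · rw [hτe]
    exact incl_injective.comp (Subtype.val_injective.comp
      (b.equivFun.symm.injective.comp E.latticeEquiv.symm.injective))
  · ext r
    constructor
    · rintro ⟨x, rfl⟩
      rw [hτe]
      exact ⟨_, (b.equivFun.symm (E.latticeEquiv.symm x)).2, rfl⟩
    · rintro ⟨x, hx, rfl⟩
      refine ⟨E.latticeEquiv (b.equivFun ⟨x, hx⟩), ?_⟩
      rw [hτb, LinearEquiv.symm_apply_apply]

/-! ### Invariants of ideal lattices, and recovery of the ideal -/

variable {E : StationaryDimensionGroup} {τ : E.Carrier →+ ℝ} {I : Ideal (𝓞 (realQuadraticField d))}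

/-- For nonzero `a ∈ I`, `√d` is itself a slope, namely `(√d · a) / a`. -/
theorem associatedField_eq (hτ : E.IsState τ) (hI : I ≠ ⊥) (hr : Set.range τ = incl d '' I) :
    E.associatedField = realQuadraticField d := by
  apply le_antisymm
  · refine IntermediateField.adjoin_le_iff.mpr fun θ hθ => ?_
    obtain ⟨x, y, -, rfl⟩ := hτ.mem_slopes_iff.mp hθ
    have h (x : E.Carrier) : τ x ∈ realQuadraticField d := by
      obtain ⟨a, -, ha⟩ : τ x ∈ incl d '' I := hr ▸ ⟨x, rfl⟩
      exact ha ▸ incl_mem a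
    exact div_mem (h x) (h y)
  · refine IntermediateField.adjoin_le_iff.mpr (Set.singleton_subset_iff.mpr ?_)
    obtain ⟨a, haI, ha0⟩ := Submodule.exists_mem_ne_zero_of_ne_bot hI
    obtain ⟨ω, hω⟩ := exists_incl_eq (sqrt_mem d) (isIntegral_sqrt ℤ)
    obtain ⟨y, hy⟩ : incl d a ∈ Set.range τ := hr ▸ ⟨a, haI, rfl⟩
    obtain ⟨x, hx⟩ : incl d (ω * a) ∈ Set.range τ := hr ▸ ⟨_, I.mul_mem_left ω haI, rfl⟩
    have hy0 : τ y ≠ 0 := by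
      rw [hy]; exact (map_ne_zero_iff _ incl_injective).mpr ha0
    refine IntermediateField.subset_adjoin _ _ (hτ.mem_slopes_iff.mpr ⟨x, y, hy0, ?_⟩)
    rw [eq_div_iff hy0, hx, hy, map_mul, hω]

/-- A multiplier of `I` is a quotient of elements of `K`, and it is integral because it stabilizes a
nonzero finitely generated subgroup of `ℝ`. -/
theorem nonempty_orderEnd_equiv (hτ : E.IsState τ) (hτi : Function.Injective τ) (hI : I ≠ ⊥)
    (hr : Set.range τ = incl d '' I) :
    Nonempty (E.orderEnd ≃+* 𝓞 (realQuadraticField d)) := by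
  have hrange : hτ.scalar.range = (incl d).range := by
    ext c
    rw [RingHom.mem_range, ← Set.mem_range, hτ.mem_range_scalar_iff hτi]
    constructor
    · intro h
      have h' (a) (ha : a ∈ I) : ∃ a' ∈ I, c * incl d a = incl d a' := by
        obtain ⟨x, hx⟩ : incl d a ∈ Set.range τ := hr ▸ ⟨a, ha, rfl⟩
        obtain ⟨y, hy⟩ := h x
        obtain ⟨a', ha', h2⟩ : τ y ∈ incl d '' I := hr ▸ ⟨y, rfl⟩
        exact ⟨a', ha', by rw [← hx, hy, h2]⟩
      obtain ⟨a, haI, ha0⟩ := Submodule.exists_mem_ne_zero_of_ne_bot hI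
      have ha0' : incl d a ≠ 0 := (map_ne_zero_iff _ incl_injective).mpr ha0
      refine exists_incl_eq ?_ ?_
      · obtain ⟨a', -, h2⟩ := h' a haI
        rw [eq_div_of_mul_eq ha0' h2]
        exact div_mem (incl_mem _) (incl_mem _)
      · let N : Submodule ℤ ℝ := τ.toIntLinearMap.range
        have hN (x : ℝ) : x ∈ N ↔ x ∈ Set.range τ := Iff.rfl
        refine isIntegral_of_smul_mem_submodule N (fun hbot => ?_) (Module.Finite.iff_fg.mp
          (Module.Finite.range τ.toIntLinearMap)) c ?_
        · have : incl d a ∈ N := (hN _).mpr (hr ▸ ⟨a, haI, rfl⟩)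
          rw [hbot] at this
          exact ha0' this
        · rintro _ ⟨x, rfl⟩
          obtain ⟨y, hy⟩ := h x
          exact ⟨y, hy.symm⟩
    · rintro ⟨y, rfl⟩ x
      obtain ⟨a, ha, h2⟩ : τ x ∈ incl d '' I := hr ▸ ⟨x, rfl⟩
      obtain ⟨z, hz⟩ : incl d (y * a) ∈ Set.range τ := hr ▸ ⟨_, I.mul_mem_left y ha, rfl⟩
      exact ⟨z, by rw [hz, ← h2, map_mul]⟩
  exact ⟨((RingEquiv.ofLeftInverse (Function.leftInverse_invFun (hτ.scalar_injective hτi))).trans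
    (RingEquiv.subringCongr hrange)).trans
      (RingEquiv.ofLeftInverse (Function.leftInverse_invFun incl_injective)).symm⟩

/-- The scaling factor is the quotient of the two generators. It may be negative, but ideals are
stable under negation, so the ordinary class group appears and not the narrow one. -/
theorem exists_image_eq_iff {I J : nonZeroDivisors (Ideal (𝓞 (realQuadraticField d)))} :
    ClassGroup.mk0 I = ClassGroup.mk0 J ↔
      ∃ c : ℝ, 0 < c ∧ incl d '' (J : Ideal (𝓞 (realQuadraticField d))) =
        (c * ·) '' (incl d '' (I : Ideal (𝓞 (realQuadraticField d)))) := by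
  rw [ClassGroup.mk0_eq_mk0_iff]
  have hne {x} (hx : x ≠ 0) : incl d x ≠ 0 := (map_ne_zero_iff _ incl_injective).mpr hx
  constructor
  · rintro ⟨x, y, hx, hy, h⟩
    have key : incl d '' (J : Ideal (𝓞 (realQuadraticField d))) =
        (incl d x / incl d y * ·) '' (incl d '' (I : Ideal (𝓞 (realQuadraticField d)))) := by
      ext r
      constructor
      · rintro ⟨j, hj, rfl⟩
        have : y * j ∈ Ideal.span {x} * (I : Ideal (𝓞 (realQuadraticField d))) :=
          h ▸ Ideal.mem_span_singleton_mul.mpr ⟨j, hj, rfl⟩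
        obtain ⟨i, hi, h2⟩ := Ideal.mem_span_singleton_mul.mp this
        refine ⟨_, ⟨i, hi, rfl⟩, ?_⟩
        have := congrArg (incl d) h2
        rw [map_mul, map_mul] at this
        change incl d x / incl d y * incl d i = incl d j
        rw [div_mul_eq_mul_div, this, mul_div_cancel_left₀ _ (hne hy)]
      · rintro ⟨_, ⟨i, hi, rfl⟩, rfl⟩
        have : x * i ∈ Ideal.span {y} * (J : Ideal (𝓞 (realQuadraticField d))) :=
          h ▸ Ideal.mem_span_singleton_mul.mpr ⟨i, hi, rfl⟩
        obtain ⟨j, hj, h2⟩ := Ideal.mem_span_singleton_mul.mp this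
        refine ⟨j, hj, ?_⟩
        have := congrArg (incl d) h2
        rw [map_mul, map_mul] at this
        change incl d j = incl d x / incl d y * incl d i
        rw [div_mul_eq_mul_div, ← this, mul_div_cancel_left₀ _ (hne hy)]
    rcases lt_or_gt_of_ne (div_ne_zero (hne hx) (hne hy)) with hc | hc
    · refine ⟨_, neg_pos.mpr hc, ?_⟩
      rw [key]
      ext r
      constructor <;>
      · rintro ⟨_, ⟨i, hi, rfl⟩, rfl⟩
        exact ⟨_, ⟨-i, neg_mem hi, rfl⟩, by simp⟩
    · exact ⟨_, hc, key⟩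
  · rintro ⟨c, hc, h⟩
    obtain ⟨a, haI, ha0⟩ := Submodule.exists_mem_ne_zero_of_ne_bot (nonZeroDivisors.ne_zero I.2)
    obtain ⟨b, hbJ, hb⟩ : c * incl d a ∈ incl d '' (J : Ideal (𝓞 (realQuadraticField d))) :=
      h ▸ ⟨_, ⟨a, haI, rfl⟩, rfl⟩
    refine ⟨b, a, ?_, ha0, ?_⟩
    · rintro rfl
      rw [map_zero] at hb
      exact mul_ne_zero hc.ne' (hne ha0) hb.symm
    · ext z
      rw [Ideal.mem_span_singleton_mul, Ideal.mem_span_singleton_mul]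
      constructor
      · rintro ⟨i, hi, rfl⟩
        obtain ⟨j, hj, h2⟩ : c * incl d i ∈ incl d '' (J : Ideal (𝓞 (realQuadraticField d))) :=
          h ▸ ⟨_, ⟨i, hi, rfl⟩, rfl⟩
        refine ⟨j, hj, incl_injective ?_⟩
        rw [map_mul, map_mul, hb, h2]; ring
      · rintro ⟨j, hj, rfl⟩
        obtain ⟨_, ⟨i, hi, rfl⟩, h2⟩ : incl d j ∈
          (c * ·) '' (incl d '' (I : Ideal (𝓞 (realQuadraticField d)))) := h ▸ ⟨j, hj, rfl⟩
        refine ⟨i, hi, incl_injective ?_⟩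
        rw [map_mul, map_mul, hb, ← h2]; ring

/-- An abstract isomorphism of the order-endomorphism ring with `O_K` need not respect the
inclusions in `ℝ`. However, an embedding with values in `K` is an injective endomorphism of `O_K`;
it extends to a `ℚ`-endomorphism of `K`, bijective by finite dimension, and integral elements have
integral preimages. -/
theorem ringHom_surjective_of_range_le {σ : 𝓞 (realQuadraticField d) →+* ℝ}
    (hinj : Function.Injective σ)
    (hσ : ∀ x, σ x ∈ realQuadraticField d) (y : 𝓞 (realQuadraticField d)) :
    ∃ x, σ x = incl d y := by
  have hlift (x) : ∃ z, incl d z = σ x :=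
    exists_incl_eq (hσ x) (x.isIntegral.map σ.toIntAlgHom)
  choose g hg using hlift
  let s : 𝓞 (realQuadraticField d) →+* 𝓞 (realQuadraticField d) :=
    { toFun := g
      map_one' := incl_injective (by rw [hg, map_one, map_one])
      map_zero' := incl_injective (by rw [hg, map_zero, map_zero])
      map_mul' := fun a b => incl_injective (by rw [hg, map_mul, map_mul, hg, hg])
      map_add' := fun a b => incl_injective (by rw [hg, map_add, map_add, hg, hg]) }
  have hsinj : Function.Injective s := fun a b h => hinj <| by
    rw [← hg, ← hg]
    exact congrArg (incl d) h
  let S : realQuadraticField d →ₐ[ℚ] realQuadraticField d :=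
    (IsFractionRing.map (K := realQuadraticField d) (L := realQuadraticField d) hsinj).toRatAlgHom
  have hS (x : 𝓞 (realQuadraticField d)) : S x = s x :=
    IsLocalization.map_eq (M := nonZeroDivisors (𝓞 (realQuadraticField d)))
      (nonZeroDivisors_le_comap_nonZeroDivisors_of_injective s hsinj) x
  obtain ⟨z, hz⟩ := (AlgHom.bijective S).2 y
  have hzint : IsIntegral ℤ z := by
    rw [← isIntegral_algHom_iff (S.restrictScalars ℤ) S.toRingHom.injective]
    change IsIntegral ℤ (S z)
    rw [hz]
    exact y.isIntegral_coe
  have hs : s ⟨z, hzint⟩ = y :=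
    NumberField.RingOfIntegers.ext ((hS ⟨z, hzint⟩).symm.trans hz)
  exact ⟨⟨z, hzint⟩, (hg _).symm.trans (congrArg (incl d) hs)⟩

/-- A stationary dimension group with associated field `K` and order-endomorphism ring `O_K` comes
from a nonzero ideal of `O_K`. -/
theorem exists_ideal_of_orderEnd_equiv (hd : Squarefree d) (hd1 : 1 < d)
    (hE : E.associatedField = realQuadraticField d)
    (φ : E.orderEnd ≃+* 𝓞 (realQuadraticField d)) :
    ∃ (τ : E.Carrier →+ ℝ) (J : Ideal (𝓞 (realQuadraticField d))), E.IsState τ ∧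
      Function.Injective τ ∧ J ≠ ⊥ ∧ Set.range τ = incl d '' J := by
  have : IsReduced E.orderEnd := isReduced_of_injective φ φ.injective
  -- A state exists because without slopes the associated field would be `ℚ`.
  obtain ⟨θ, τ, hτ, x, y, hy, -⟩ : E.slopes.Nonempty := by
    by_contra! h
    have h1 : realQuadraticField d = ⊥ := by
      rw [← hE, StationaryDimensionGroup.associatedField, h, IntermediateField.adjoin_empty]
    have h2 := finrank_eq hd hd1
    rw [h1, IntermediateField.finrank_bot] at h2
    omega
  have hτi : Function.Injective τ := hτ.injective_of_isReduced
  obtain ⟨y, hy⟩ := hτ.exists_pos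
  have hK (x : E.Carrier) : τ x / τ y ∈ realQuadraticField d := by
    rw [← hE]
    exact IntermediateField.subset_adjoin _ _ (hτ.mem_slopes_iff.mpr ⟨x, y, hy.ne', rfl⟩)
  have hmul (a : 𝓞 (realQuadraticField d)) (x : E.Carrier) : ∃ z, incl d a * τ x = τ z := by
    obtain ⟨w, hw⟩ := ringHom_surjective_of_range_le
      (σ := hτ.scalar.comp φ.symm.toRingHom)
      ((hτ.scalar_injective hτi).comp φ.symm.injective) (fun w => by
      change hτ.scalar (φ.symm w) ∈ _
      rw [eq_div_of_mul_eq hy.ne' (hτ.scalar_mul _ y)]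
      exact hK _) a
    rw [← hw]
    exact ⟨_, hτ.scalar_mul (φ.symm w) x⟩
  obtain ⟨m, hm0, hm⟩ : ∃ m : 𝓞 (realQuadraticField d), m ≠ 0 ∧
      ∀ x, ∃ z, incl d z = incl d m * (τ x / τ y) := by
    obtain ⟨m, hm⟩ := IsLocalization.exist_integer_multiples_of_finite
      (nonZeroDivisors (𝓞 (realQuadraticField d)))
      (fun i : Fin E.n => (⟨_, hK (E.latticeEquiv (Pi.single i 1))⟩ : realQuadraticField d))
    refine ⟨m, nonZeroDivisors.ne_zero m.2, fun x => ?_⟩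
    obtain ⟨v, rfl⟩ := E.latticeEquiv.surjective x
    choose z hz using hm
    refine ⟨∑ i, v i • z i, ?_⟩
    have hz' (i) : incl d (z i) = incl d m * (τ (E.latticeEquiv (Pi.single i 1)) / τ y) := by
      have := congrArg (algebraMap (realQuadraticField d) ℝ) (hz i)
      rw [Algebra.smul_def, map_mul] at this
      exact this
    have hv : v = ∑ i, v i • Pi.single i (1 : ℤ) := by
      ext j
      simp [Finset.sum_apply, Pi.single_apply]
    conv_rhs => rw [hv]
    simp only [map_sum, map_zsmul, hz', Finset.sum_div, Finset.mul_sum]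
    exact Finset.sum_congr rfl fun i _ => by rw [zsmul_eq_mul, zsmul_eq_mul]; ring
  -- One factor `m` clears denominators; the second makes the scaling positive whatever the sign of
  -- `m`.
  have hc : 0 < incl d m ^ 2 / τ y :=
    div_pos (sq_pos_of_ne_zero ((map_ne_zero_iff _ incl_injective).mpr hm0)) hy
  let J : Ideal (𝓞 (realQuadraticField d)) :=
    { carrier := {z | ∃ x, incl d z = incl d m ^ 2 / τ y * τ x}
      zero_mem' := ⟨0, by simp⟩
      add_mem' := by
        rintro _ _ ⟨x, hx⟩ ⟨x', hx'⟩
        exact ⟨x + x', by rw [map_add, map_add, hx, hx', mul_add]⟩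
      smul_mem' := by
        rintro a z ⟨x, hx⟩
        obtain ⟨x', hx'⟩ := hmul a x
        exact ⟨x', by rw [smul_eq_mul, map_mul, hx, ← hx']; ring⟩ }
  have hJ (x : E.Carrier) : ∃ z ∈ J, incl d z = incl d m ^ 2 / τ y * τ x := by
    obtain ⟨z, hz⟩ := hm x
    have : incl d (m * z) = incl d m ^ 2 / τ y * τ x := by rw [map_mul, hz]; ring
    exact ⟨m * z, ⟨x, this⟩, this⟩
  refine ⟨_, J, hτ.smul hc, (mul_right_injective₀ hc.ne').comp hτi, ?_, ?_⟩
  · intro hbot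
    obtain ⟨z, hz, h⟩ := hJ y
    rw [hbot, Ideal.mem_bot] at hz
    rw [hz, map_zero] at h
    exact (mul_pos hc hy).ne h
  · ext r
    constructor
    · rintro ⟨x, rfl⟩
      exact hJ x
    · rintro ⟨z, ⟨x, hx⟩, rfl⟩
      exact ⟨x, hx.symm⟩

end RealQuadratic

end

/-! ### Counting by ideal classes -/

theorem lemma6 (E : StationaryDimensionGroup) (d : ℕ) (hd : Squarefree d) (hd1 : 1 < d)
    (hE : E.associatedField = realQuadraticField d)
    (hh : 1 < NumberField.classNumber (realQuadraticField d)) :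
    ∃ F : Fin (NumberField.classNumber (realQuadraticField d)) → StationaryDimensionGroup,
      (∀ i, (F i).associatedField = realQuadraticField d ∧
        Nonempty ((F i).orderEnd ≃+* 𝓞 (realQuadraticField d))) ∧
      Function.Injective (fun i => (F i).moritaClass) ∧
      ∀ E' : StationaryDimensionGroup, E'.associatedField = realQuadraticField d →
        Nonempty (E'.orderEnd ≃+* 𝓞 (realQuadraticField d)) →
        ∃ i, E'.moritaClass = (F i).moritaClass := by
  have e : Fin (NumberField.classNumber (realQuadraticField d)) ≃
      ClassGroup (𝓞 (realQuadraticField d)) := (Fintype.equivFin _).symm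
  choose I hI using ClassGroup.mk0_surjective (R := 𝓞 (realQuadraticField d))
  have hne (J : nonZeroDivisors (Ideal (𝓞 (realQuadraticField d)))) :
      (J : Ideal (𝓞 (realQuadraticField d))) ≠ ⊥ :=
    nonZeroDivisors.ne_zero J.2
  choose G τ hτ hτi hr using fun c =>
    RealQuadratic.exists_stationaryDimensionGroup hd hd1 (I c) (hne _)
  -- Applied to the groups `G c` themselves this gives distinctness; applied to an arbitrary `E'` it
  -- gives exhaustiveness.
  have hclass (E' : StationaryDimensionGroup) (σ : E'.Carrier →+ ℝ) (hσ : E'.IsState σ)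
      (hσi : Function.Injective σ) (J : nonZeroDivisors (Ideal (𝓞 (realQuadraticField d))))
      (hJ : Set.range σ = RealQuadratic.incl d '' (J : Ideal (𝓞 (realQuadraticField d)))) (c) :
      E'.moritaClass = (G c).moritaClass ↔ ClassGroup.mk0 J = c := by
    rw [StationaryDimensionGroup.moritaClass_eq_iff,
      StationaryDimensionGroup.moritaEquiv_iff hσ (hτ c) hσi (hτi c), hJ, hr,
      ← RealQuadratic.exists_image_eq_iff, hI]
  refine ⟨fun i => G (e i), fun i => ⟨RealQuadratic.associatedField_eq (hτ _) (hne _) (hr _),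
    RealQuadratic.nonempty_orderEnd_equiv (hτ _) (hτi _) (hne _) (hr _)⟩, fun i j h => ?_, ?_⟩
  · have := (hclass _ _ (hτ _) (hτi _) _ (hr _) _).mp h
    rw [hI] at this
    exact e.injective this
  · rintro E' hE' ⟨φ⟩
    obtain ⟨σ, J, hσ, hσi, hJ0, hJ⟩ := RealQuadratic.exists_ideal_of_orderEnd_equiv hd hd1 hE' φ
    obtain ⟨i, hi⟩ := e.surjective (ClassGroup.mk0 ⟨J, mem_nonZeroDivisors_of_ne_zero hJ0⟩)
    exact ⟨i, (hclass E' σ hσ hσi ⟨J, mem_nonZeroDivisors_of_ne_zero hJ0⟩ hJ _).mpr hi.symm⟩
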